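/- Let $N_C,N_R,N_S,N_B,N_D$ be non-negative integers. Let $H\in\mathbb{C}^{(N_CN_R)\times N_S}$ and $G\in\mathbb{C}^{N_D\times(N_CN_R)}$ be random matrices on a probability space such that $G$ is independent of $H$ and the entries of $G$ are i.i.d. unit-variance circularly symmetric complex Gaussian variables; the law of $H$ is arbitrary. Let $F\in\mathbb{C}^{(N_CN_R)\times(N_CN_R)}$ and $F_0\in\mathbb{C}^{N_S\times N_B}$ be measurable functions of $H$ (in particular, they may be constant). Put $C=GFHF_0$, so that $C^{\mathsf H}C=F_0^{\mathsf H}H^{\mathsf H}F^{\mathsf H}G^{\mathsf H}GFHF_0$, and $R=F_0^{\mathsf H}H^{\mathsf H}F^{\mathsf H}FHF_0\in\mathbb{C}^{N_B\times N_B}$. Assume that, almost surely, (a1) $\operatorname{rank}(F_0)=N_B$, (a2) $\operatorname{rank}(GFH)=N_S$, and that (a3) $N_D>N_B$. Then, for almost every value of $H$, $R$ is invertible, $C^{\mathsf H}C$ is almost surely invertible under the conditional law of $G$ given $H$, $\operatorname{tr}\big((C^{\mathsf H}C)^{-1}\big)$ is integrable under this conditional law, and $$\mathbb{E}_G\Big[\operatorname{tr}\big((F_0^{\mathsf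 H}H^{\mathsf H}F^{\mathsf H}G^{\mathsf H}GFHF_0)^{-1}\big)\,\Big|\,H\Big]=\frac{\operatorname{tr}(R^{-1})}{N_D-N_B},$$ where $\mathbb{E}_G[\,\cdot\mid H]$ is the integral with respect to the conditional law of $G$ given $H$. If moreover $\operatorname{tr}\big((C^{\mathsf H}C)^{-1}\big)$ is integrable on the probability space, then the same identity holds almost surely with the left-hand side read as the conditional expectation given the $\sigma$-algebra generated by $H$. -/

import Mathlib

open MeasureTheory ProbabilityTheory
open scoped Matrix

noncomputable section

/-- The unit-variance circularly symmetric complex Gaussian law on `ℂ`: the law of `X + i Y` with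
`X`, `Y` independent real centred Gaussian variables of variance `1 / 2` each. -/
def cscg : Measure ℂ :=
  ((gaussianReal 0 (1 / 2)).prod (gaussianReal 0 (1 / 2))).map
    (fun p : ℝ × ℝ => (p.1 : ℂ) + (p.2 : ℂ) * Complex.I)

/-- Complex matrices carry the product sigma-algebra of their entries. -/
instance instMeasurableSpaceMatrix {m n : Type*} : MeasurableSpace (Matrix m n ℂ) :=
  inferInstanceAs (MeasurableSpace (m → n → ℂ))

instance instStandardBorelSpaceMatrix {m n : Type*} [Countable m] [Countable n] :
    StandardBorelSpace (Matrix m n ℂ) :=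
  inferInstanceAs (StandardBorelSpace (m → n → ℂ))

/-- The entries of the random matrix `G` are independent, each with law `cscg`. -/
structure HasIIDCSCGEntries {Ω m n : Type*} [MeasurableSpace Ω]
    (G : Ω → Matrix m n ℂ) (P : Measure Ω) : Prop where
  hasLaw : ∀ i j, HasLaw (fun ω => G ω i j) cscg P
  indep : iIndepFun (fun (p : m × n) (ω : Ω) => G ω p.1 p.2) P

/-- Dual-hop channel matrix `C = G F H F₀`. -/
def dualHop {d r s b : Type*} [Fintype r] [Fintype s]
    (G : Matrix d r ℂ) (F : Matrix r r ℂ) (H : Matrix r s ℂ) (F₀ : Matrix s b ℂ) :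
    Matrix d b ℂ :=
  G * F * H * F₀

/-- The matrix `R = F₀ᴴ Hᴴ Fᴴ F H F₀`. -/
def gramR {r s b : Type*} [Fintype r] [Fintype s]
    (F : Matrix r r ℂ) (H : Matrix r s ℂ) (F₀ : Matrix s b ℂ) : Matrix b b ℂ :=
  F₀ᴴ * Hᴴ * Fᴴ * F * H * F₀

/-- The matrix `Cᴴ C = F₀ᴴ Hᴴ Fᴴ Gᴴ G F H F₀`. -/
def gramC {d r s b : Type*} [Fintype d] [Fintype r] [Fintype s]
    (G : Matrix d r ℂ) (F : Matrix r r ℂ) (H : Matrix r s ℂ) (F₀ : Matrix s b ℂ) :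
    Matrix b b ℂ :=
  (dualHop G F H F₀)ᴴ * dualHop G F H F₀

end

/-! By independence, the conditional law of `G` given `H = h` is the law of `G`, so the claim
concerns a standard Gaussian matrix `X` and the fixed matrix `A = F H F₀`, with `R = Aᴴ A`. Write `A
= U D Wᴴ` with `U` having orthonormal columns, `W` unitary and `D` the diagonal of singular values
`δ i`. Then `B = X U` is again standard Gaussian, and since `W` drops out of the trace, `tr ((X A)ᴴ
(X A))⁻¹ = ∑ i, δ i ^ (-2) * (Bᴴ B)⁻¹ i i`, while `tr R⁻¹ = ∑ i, δ i ^ (-2)`.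

It remains to see that each `(Bᴴ B)⁻¹ i i` has mean `1 / (N_D - N_B)`. This entry is the inverse
squared distance from column `i` to the span of the others (`inv_gram_diag_mul_sum_norm_sq`). With
the others fixed, that distance is the norm of a standard Gaussian vector in dimension `N_D - N_B +
1`, and the inverse squared norm in dimension `n + 1` has mean `1 / n`
(`lintegral_inv_sum_norm_sq_cscgPi`). -/

/-! ### Complex Gaussian vectors and their unitary invariance -/

lemma measurable_ofReal_add_ofReal_mul_I :
    Measurable (fun p : ℝ × ℝ => (p.1 : ℂ) + (p.2 : ℂ) * Complex.I) := by fun_prop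

instance isProbabilityMeasure_cscg : IsProbabilityMeasure cscg :=
  Measure.isProbabilityMeasure_map measurable_ofReal_add_ofReal_mul_I.aemeasurable

lemma integral_cexp_re_mul_cscg (c : ℂ) :
    ∫ z, Complex.exp (((c * z).re : ℂ) * Complex.I) ∂cscg =
      Complex.exp (-((‖c‖ ^ 2 : ℝ) : ℂ) / 4) := by
  have hcont : Continuous fun z : ℂ => Complex.exp (((c * z).re : ℂ) * Complex.I) := by fun_prop
  rw [cscg, integral_map measurable_ofReal_add_ofReal_mul_I.aemeasurable
    hcont.aestronglyMeasurable]
  have hsplit : ∀ p : ℝ × ℝ,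
      Complex.exp (((c * ((p.1 : ℂ) + (p.2 : ℂ) * Complex.I)).re : ℂ) * Complex.I) =
        Complex.exp ((c.re : ℂ) * p.1 * Complex.I) *
          Complex.exp (((-c.im : ℝ) : ℂ) * p.2 * Complex.I) := by
    intro p
    rw [← Complex.exp_add]
    congr 1
    simp
    ring
  simp_rw [hsplit]
  rw [integral_prod_mul (fun x : ℝ => Complex.exp ((c.re : ℂ) * x * Complex.I))
    (fun y : ℝ => Complex.exp (((-c.im : ℝ) : ℂ) * y * Complex.I)),
    ← charFun_apply_real, ← charFun_apply_real, charFun_gaussianReal, charFun_gaussianReal,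
    ← Complex.exp_add]
  congr 1
  rw [← Complex.normSq_eq_norm_sq, Complex.normSq_apply]
  push_cast
  ring

section Gaussian

variable {ι κ : Type*} [Fintype ι] [Fintype κ]

/-- The standard complex Gaussian measure on `ι → ℂ`, with independent `cscg` coordinates. -/
noncomputable def cscgPi (ι : Type*) [Fintype ι] : Measure (ι → ℂ) :=
  Measure.pi fun _ => cscg

instance isProbabilityMeasure_cscgPi : IsProbabilityMeasure (cscgPi ι) := by
  unfold cscgPi; infer_instance

lemma integral_cexp_re_dotProduct_cscgPi (c : ι → ℂ) :
    ∫ x, Complex.exp (((c ⬝ᵥ x).re : ℂ) * Complex.I) ∂(cscgPi ι) =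
      Complex.exp (-((∑ i, ‖c i‖ ^ 2 : ℝ) : ℂ) / 4) := by
  have hprod : ∀ x : ι → ℂ, Complex.exp (((c ⬝ᵥ x).re : ℂ) * Complex.I) =
      ∏ i, Complex.exp (((c i * x i).re : ℂ) * Complex.I) := by
    intro x
    rw [← Complex.exp_sum, dotProduct, Complex.re_sum, Complex.ofReal_sum, Finset.sum_mul]
  simp_rw [hprod]
  rw [cscgPi, integral_fintype_prod_eq_prod
    (fun i (z : ℂ) => Complex.exp (((c i * z).re : ℂ) * Complex.I))]
  simp_rw [integral_cexp_re_mul_cscg]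
  rw [← Complex.exp_sum]
  push_cast
  rw [← Finset.sum_div, Finset.sum_neg_distrib]

/-- `charFunDual` tests against real-linear functionals; such a functional is fixed by its values on
`e_i` and `I e_i`, which gives `c`. -/
lemma exists_eq_re_dotProduct [DecidableEq ι] (L : StrongDual ℝ (ι → ℂ)) :
    ∃ c : ι → ℂ, ∀ x, L x = (c ⬝ᵥ x).re := by
  refine ⟨fun i => (L (Pi.single i 1) : ℂ) - (L (Pi.single i Complex.I) : ℂ) * Complex.I,
    fun x => ?_⟩
  have hx : x = ∑ i, ((x i).re • (Pi.single i (1 : ℂ) : ι → ℂ) +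
      (x i).im • (Pi.single i Complex.I : ι → ℂ)) := by
    ext j
    simp [Finset.sum_apply, Pi.single_apply, Finset.sum_add_distrib]
  conv_lhs => rw [hx]
  rw [map_sum, dotProduct, Complex.re_sum]
  refine Finset.sum_congr rfl fun i _ => ?_
  simp
  ring

lemma eq_cscgPi_of_integral_cexp {ν : Measure (ι → ℂ)} [IsFiniteMeasure ν]
    (h : ∀ c : ι → ℂ, ∫ x, Complex.exp (((c ⬝ᵥ x).re : ℂ) * Complex.I) ∂ν =
      Complex.exp (-((∑ i, ‖c i‖ ^ 2 : ℝ) : ℂ) / 4)) : ν = cscgPi ι := by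
  classical
  refine Measure.ext_of_charFunDual ?_
  ext L
  obtain ⟨c, hc⟩ := exists_eq_re_dotProduct L
  simp_rw [charFunDual_apply, hc]
  rw [h, integral_cexp_re_dotProduct_cscgPi]

lemma ofReal_sum_norm_sq (v : ι → ℂ) : ((∑ i, ‖v i‖ ^ 2 : ℝ) : ℂ) = v ⬝ᵥ star v := by
  simp [dotProduct, Complex.mul_conj, Complex.normSq_eq_norm_sq]

/-- Source of the invariance of the Gaussian law: testing `T *ᵥ x` against `c` is testing `x`
against `c ᵥ* T`, and the characteristic function sees only the norm. -/
lemma sum_norm_sq_vecMul [DecidableEq κ] {T : Matrix κ ι ℂ} (hT : T * Tᴴ = 1) (c : κ → ℂ) :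
    ∑ i, ‖(c ᵥ* T) i‖ ^ 2 = ∑ k, ‖c k‖ ^ 2 := by
  apply Complex.ofReal_injective
  rw [ofReal_sum_norm_sq, ofReal_sum_norm_sq, Matrix.star_vecMul, Matrix.dotProduct_mulVec, Matrix.vecMul_vecMul, hT,
    Matrix.vecMul_one]

/-- A matrix with orthonormal rows maps a standard complex Gaussian to a standard complex
Gaussian. -/
lemma measurePreserving_mulVec_cscgPi [DecidableEq κ] {T : Matrix κ ι ℂ} (hT : T * Tᴴ = 1) :
    MeasurePreserving (fun x => T *ᵥ x) (cscgPi ι) (cscgPi κ) := by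
  have hm : Measurable fun x : ι → ℂ => T *ᵥ x := by
    refine measurable_pi_lambda _ fun k => ?_
    simp only [Matrix.mulVec, dotProduct]
    fun_prop
  have : IsProbabilityMeasure ((cscgPi ι).map fun x => T *ᵥ x) :=
    Measure.isProbabilityMeasure_map hm.aemeasurable
  refine ⟨hm, eq_cscgPi_of_integral_cexp fun c => ?_⟩
  have hcont : Continuous fun x : κ → ℂ => Complex.exp (((c ⬝ᵥ x).re : ℂ) * Complex.I) := by
    simp only [dotProduct]
    fun_prop
  rw [integral_map hm.aemeasurable hcont.aestronglyMeasurable]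
  simp_rw [Matrix.dotProduct_mulVec]
  rw [integral_cexp_re_dotProduct_cscgPi, sum_norm_sq_vecMul hT]

end Gaussian

/-! ### Inverse moment of the squared norm -/

open Real in
lemma integral_exp_neg_mul_sq_gaussianReal {t : ℝ} (ht : 0 ≤ t) :
    ∫ x, exp (-t * x ^ 2) ∂(gaussianReal 0 (1 / 2)) = √((1 + t)⁻¹) := by
  rw [integral_gaussianReal_eq_integral_smul (by norm_num)]
  -- Variance `1 / 2` makes the density `exp (-x ^ 2) / √π`.
  have hfun : ∀ x : ℝ, gaussianPDFReal 0 (1 / 2) x • exp (-t * x ^ 2) =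
      (√π)⁻¹ * exp (-(1 + t) * x ^ 2) := by
    intro x
    rw [gaussianPDFReal, smul_eq_mul, mul_assoc, ← exp_add]
    congr 3
    · norm_num
      ring
    · norm_num
      ring
  simp_rw [hfun]
  rw [integral_const_mul, integral_gaussian, ← sqrt_inv, ← sqrt_mul (by positivity)]
  congr 1
  field_simp

open Real in
lemma integral_exp_neg_mul_norm_sq_cscg {t : ℝ} (ht : 0 ≤ t) :
    ∫ z, exp (-t * ‖z‖ ^ 2) ∂cscg = (1 + t)⁻¹ := by
  have hcont : Continuous fun z : ℂ => exp (-t * ‖z‖ ^ 2) := by fun_prop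
  rw [cscg, integral_map measurable_ofReal_add_ofReal_mul_I.aemeasurable
    hcont.aestronglyMeasurable]
  have hsplit : ∀ p : ℝ × ℝ, exp (-t * ‖(p.1 : ℂ) + (p.2 : ℂ) * Complex.I‖ ^ 2) =
      exp (-t * p.1 ^ 2) * exp (-t * p.2 ^ 2) := by
    intro p
    rw [← exp_add, ← Complex.normSq_eq_norm_sq, Complex.normSq_add_mul_I]
    congr 1
    ring
  simp_rw [hsplit]
  rw [integral_prod_mul (fun x : ℝ => exp (-t * x ^ 2)) (fun x : ℝ => exp (-t * x ^ 2)),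
    integral_exp_neg_mul_sq_gaussianReal ht, mul_self_sqrt (by positivity)]

open Real in
lemma lintegral_exp_neg_mul_sum_norm_sq_cscgPi {κ : Type*} [Fintype κ] {t : ℝ} (ht : 0 ≤ t) :
    ∫⁻ x, ENNReal.ofReal (exp (-(∑ k, ‖x k‖ ^ 2) * t)) ∂(cscgPi κ) =
      ENNReal.ofReal (((1 + t) ^ Fintype.card κ)⁻¹) := by
  have hcont : Continuous fun x : κ → ℂ => exp (-(∑ k, ‖x k‖ ^ 2) * t) := by fun_prop
  have hint : Integrable (fun x : κ → ℂ => exp (-(∑ k, ‖x k‖ ^ 2) * t)) (cscgPi κ) := by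
    refine Integrable.of_bound hcont.aestronglyMeasurable 1 (ae_of_all _ fun x => ?_)
    rw [Real.norm_eq_abs, abs_exp, exp_le_one_iff, neg_mul]
    have : 0 ≤ ∑ k, ‖x k‖ ^ 2 := Finset.sum_nonneg fun k _ => by positivity
    nlinarith [mul_nonneg this ht]
  rw [← ofReal_integral_eq_lintegral_ofReal hint (ae_of_all _ fun x => (exp_pos _).le)]
  congr 1
  have hprod : ∀ x : κ → ℂ, exp (-(∑ k, ‖x k‖ ^ 2) * t) = ∏ k, exp (-t * ‖x k‖ ^ 2) := by
    intro x
    rw [← exp_sum, ← Finset.mul_sum]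
    congr 1
    ring
  simp_rw [hprod]
  rw [cscgPi, integral_fintype_prod_eq_prod (fun _ (z : ℂ) => exp (-t * ‖z‖ ^ 2))]
  simp only [integral_exp_neg_mul_norm_sq_cscg ht, Finset.prod_const, Finset.card_univ, inv_pow]

/-- Turns an inverse into exponentials, which factor over coordinates. At `s = 0` both sides are
`∞`, so the zero vector needs no exclusion. -/
lemma lintegral_Ioi_exp_neg_mul {s : ℝ} (hs : 0 ≤ s) :
    ∫⁻ t in Set.Ioi (0 : ℝ), ENNReal.ofReal (Real.exp (-s * t)) = (ENNReal.ofReal s)⁻¹ := by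
  rcases hs.eq_or_lt with rfl | hs
  · simp
  · rw [← ofReal_integral_eq_lintegral_ofReal
      (integrableOn_exp_mul_Ioi (neg_lt_zero.2 hs) 0) (ae_of_all _ fun x => (Real.exp_pos _).le),
      integral_exp_mul_Ioi (neg_lt_zero.2 hs), ← ENNReal.ofReal_inv_of_pos hs]
    simp

lemma lintegral_Ioi_inv_one_add_pow {n : ℕ} (hn : 0 < n) :
    ∫⁻ t in Set.Ioi (0 : ℝ), ENNReal.ofReal (((1 + t) ^ (n + 1))⁻¹) =
      ENNReal.ofReal ((n : ℝ)⁻¹) := by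
  have hn' : (n : ℝ) ≠ 0 := by positivity
  have hder : ∀ t ∈ Set.Ici (0 : ℝ),
      HasDerivAt (fun t : ℝ => -(n : ℝ)⁻¹ * ((1 + t) ^ n)⁻¹) (((1 + t) ^ (n + 1))⁻¹) t := by
    intro t ht
    have ht' : (1 + t) ≠ 0 := by
      have : (0 : ℝ) ≤ t := ht
      positivity
    have h := ((((hasDerivAt_id t).const_add 1).pow n).inv (pow_ne_zero n ht')).const_mul
      (-(n : ℝ)⁻¹)
    refine h.congr_deriv ?_
    obtain ⟨m, rfl⟩ := Nat.exists_eq_succ_of_ne_zero hn.ne'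
    simp only [Nat.succ_eq_add_one, Nat.add_sub_cancel, id, Pi.pow_apply] at hn' ⊢
    field_simp
    ring
  have hpos : ∀ t ∈ Set.Ioi (0 : ℝ), 0 ≤ ((1 + t) ^ (n + 1))⁻¹ := by
    intro t ht
    have : (0 : ℝ) < t := ht
    positivity
  have hlim : Filter.Tendsto (fun t : ℝ => -(n : ℝ)⁻¹ * ((1 + t) ^ n)⁻¹) Filter.atTop
      (nhds 0) := by
    have h : Filter.Tendsto (fun t : ℝ => ((1 + t) ^ n)⁻¹) Filter.atTop (nhds 0) :=
      Filter.Tendsto.inv_tendsto_atTop ((Filter.tendsto_pow_atTop hn.ne').comp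
        (Filter.tendsto_atTop_add_const_left _ _ Filter.tendsto_id))
    simpa using h.const_mul (-(n : ℝ)⁻¹)
  rw [← ofReal_integral_eq_lintegral_ofReal (integrableOn_Ioi_deriv_of_nonneg' hder hpos hlim)
    ((ae_restrict_iff' measurableSet_Ioi).2 (ae_of_all _ hpos)),
    integral_Ioi_of_hasDerivAt_of_nonneg' hder hpos hlim]
  simp

/-- The mean of the inverse squared norm of a standard complex Gaussian vector. -/
lemma lintegral_inv_sum_norm_sq_cscgPi {κ : Type*} [Fintype κ] {n : ℕ} (hn : 0 < n)
    (hκ : Fintype.card κ = n + 1) :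
    ∫⁻ x, (ENNReal.ofReal (∑ k, ‖x k‖ ^ 2))⁻¹ ∂(cscgPi κ) = ENNReal.ofReal ((n : ℝ)⁻¹) := by
  have hcont : Continuous fun p : (κ → ℂ) × ℝ =>
      ENNReal.ofReal (Real.exp (-(∑ k, ‖p.1 k‖ ^ 2) * p.2)) :=
    ENNReal.continuous_ofReal.comp (by fun_prop)
  -- Tonelli reduces the mean to the integral of the Laplace transform `(1 + t) ^ (-(n + 1))`.
  calc ∫⁻ x, (ENNReal.ofReal (∑ k, ‖x k‖ ^ 2))⁻¹ ∂(cscgPi κ)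
      = ∫⁻ x, (∫⁻ t in Set.Ioi (0 : ℝ),
          ENNReal.ofReal (Real.exp (-(∑ k, ‖x k‖ ^ 2) * t))) ∂(cscgPi κ) :=
        lintegral_congr fun x =>
          (lintegral_Ioi_exp_neg_mul (Finset.sum_nonneg fun k _ => by positivity)).symm
    _ = ∫⁻ t in Set.Ioi (0 : ℝ), ∫⁻ x,
          ENNReal.ofReal (Real.exp (-(∑ k, ‖x k‖ ^ 2) * t)) ∂(cscgPi κ) :=
        lintegral_lintegral_swap hcont.measurable.aemeasurable
    _ = ∫⁻ t in Set.Ioi (0 : ℝ), ENNReal.ofReal (((1 + t) ^ (n + 1))⁻¹) := by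
        refine setLIntegral_congr_fun measurableSet_Ioi fun t ht => ?_
        rw [lintegral_exp_neg_mul_sum_norm_sq_cscgPi (le_of_lt ht), hκ]
    _ = ENNReal.ofReal ((n : ℝ)⁻¹) := lintegral_Ioi_inv_one_add_pow hn

/-! ### Gram matrices, orthogonal complements and singular values -/

section LinearAlgebra

variable {d r b : Type*} [Fintype d] [Fintype r] [Fintype b]

/-- If the rows of `V` form an orthonormal basis of the orthogonal complement of the columns of
`X` other than the `i`-th one, then the `i`-th diagonal entry of `(Xᴴ X)⁻¹` is the inverse of the
squared distance from the `i`-th column to the span of the other columns. -/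
lemma inv_gram_diag_mul_sum_norm_sq [DecidableEq b] {κ : Type*} [Fintype κ] {X : Matrix d b ℂ}
    (hX : IsUnit (Xᴴ * X).det) (i : b) {V : Matrix κ d ℂ}
    (hVX : ∀ j, j ≠ i → V *ᵥ X.col j = 0)
    (hV : ∀ u : d → ℂ, (∀ j, j ≠ i → star (X.col j) ⬝ᵥ u = 0) → Vᴴ *ᵥ (V *ᵥ u) = u) :
    (Xᴴ * X)⁻¹ i i * ((∑ k, ‖(V *ᵥ X.col i) k‖ ^ 2 : ℝ) : ℂ) = 1 := by
  -- The vector `u = X w` is dual to the columns: orthogonal to all but the `i`-th, with product 1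
  -- against that one. Hence `‖u‖² = w i`, and `V *ᵥ u = w i • V *ᵥ X.col i` has the same norm as
  -- `u`.
  set w : b → ℂ := (Xᴴ * X)⁻¹ *ᵥ Pi.single i 1 with hw
  set u : d → ℂ := X *ᵥ w with hu
  have hwi : w i = (Xᴴ * X)⁻¹ i i := by simp [hw]
  have hXu : Xᴴ *ᵥ u = Pi.single i 1 := by
    rw [hu, hw, Matrix.mulVec_mulVec, Matrix.mulVec_mulVec, Matrix.mul_nonsing_inv _ hX,
      Matrix.one_mulVec]
  have horth : ∀ j, j ≠ i → star (X.col j) ⬝ᵥ u = 0 := by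
    intro j hj
    have h := congrFun hXu j
    rw [Pi.single_eq_of_ne hj] at h
    exact h
  have hVu : V *ᵥ u = w i • V *ᵥ X.col i := by
    have hsum : X *ᵥ w = ∑ j, w j • X.col j := by
      ext a
      simp [Matrix.mulVec, dotProduct, mul_comm]
    rw [hu, hsum, Matrix.mulVec_sum, Finset.sum_eq_single i]
    · rw [Matrix.mulVec_smul]
    · intro j _ hj
      rw [Matrix.mulVec_smul, hVX j hj, smul_zero]
    · simp
  have hwu : w i = u ⬝ᵥ star u := by
    calc w i = star (Xᴴ *ᵥ u) ⬝ᵥ w := by rw [hXu]; simp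
      _ = star u ⬝ᵥ u := by
        rw [Matrix.star_mulVec, Matrix.conjTranspose_conjTranspose, ← Matrix.dotProduct_mulVec]
      _ = u ⬝ᵥ star u := dotProduct_comm _ _
  have hreal : star (w i) = w i := by
    rw [hwu, ← ofReal_sum_norm_sq, Complex.star_def, Complex.conj_ofReal]
  have hne : w i ≠ 0 := by
    intro h0
    have hu0 : u = 0 := by
      open scoped ComplexOrder in
      rw [← dotProduct_self_star_eq_zero, ← hwu, h0]
    rw [hu0, Matrix.mulVec_zero] at hXu
    simpa using congrFun hXu i
  have hnorm : w i = w i * w i * ((∑ k, ‖(V *ᵥ X.col i) k‖ ^ 2 : ℝ) : ℂ) := by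
    calc w i = star u ⬝ᵥ Vᴴ *ᵥ (V *ᵥ u) := by rw [hV u horth, hwu, dotProduct_comm]
      _ = (V *ᵥ u) ⬝ᵥ star (V *ᵥ u) := by
          rw [Matrix.dotProduct_mulVec, ← Matrix.star_mulVec, dotProduct_comm]
      _ = w i * w i * ((∑ k, ‖(V *ᵥ X.col i) k‖ ^ 2 : ℝ) : ℂ) := by
          rw [hVu, ofReal_sum_norm_sq, star_smul, smul_dotProduct, dotProduct_smul, hreal]
          simp only [smul_eq_mul]
          ring
  rw [← hwi]
  refine mul_left_cancel₀ hne ?_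
  rw [← mul_assoc, ← hnorm, mul_one]

/-- An orthonormal basis of the orthogonal complement of a linearly independent family, as the rows
of a matrix. -/
lemma exists_orthonormal_rows_compl {τ : Type*} [Fintype τ] {y : τ → d → ℂ}
    (hy : LinearIndependent ℂ y) {m : ℕ} (hm : Fintype.card d = Fintype.card τ + m) :
    ∃ V : Matrix (Fin m) d ℂ, V * Vᴴ = 1 ∧ (∀ j, V *ᵥ y j = 0) ∧
      ∀ u : d → ℂ, (∀ j, star (y j) ⬝ᵥ u = 0) → Vᴴ *ᵥ (V *ᵥ u) = u := by
  set Y : τ → EuclideanSpace ℂ d := fun j => WithLp.toLp 2 (y j) with hY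
  have hYli : LinearIndependent ℂ Y :=
    hy.map' (WithLp.linearEquiv 2 ℂ (d → ℂ)).symm.toLinearMap (LinearEquiv.ker _)
  set K : Submodule ℂ (EuclideanSpace ℂ d) := (Submodule.span ℂ (Set.range Y))ᗮ with hK
  have hdim : Module.finrank ℂ K = m := by
    have h1 := Submodule.finrank_add_finrank_orthogonal (Submodule.span ℂ (Set.range Y))
    rw [← hK, finrank_span_eq_card hYli, finrank_euclideanSpace, hm] at h1
    omega
  let B : OrthonormalBasis (Fin m) ℂ K := (stdOrthonormalBasis ℂ K).reindex (finCongr hdim)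
  -- The rows are conjugated so that `V *ᵥ x` lists the inner products with the basis.
  let V : Matrix (Fin m) d ℂ := Matrix.of fun k a => star ((B k : EuclideanSpace ℂ d) a)
  have hVx : ∀ (x : d → ℂ) k, (V *ᵥ x) k = inner ℂ (B k : EuclideanSpace ℂ d) (WithLp.toLp 2 x) := by
    intro x k
    simp [V, Matrix.mulVec, dotProduct, PiLp.inner_apply, mul_comm]
  refine ⟨V, ?_, ?_, ?_⟩
  · ext k l
    have h := orthonormal_iff_ite.1 B.orthonormal k l
    rw [Submodule.coe_inner] at h
    rw [Matrix.one_apply, ← h]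
    simp [V, Matrix.mul_apply, PiLp.inner_apply, mul_comm]
  · intro j
    ext k
    rw [hVx]
    exact Submodule.inner_left_of_mem_orthogonal
      (Submodule.subset_span (Set.mem_range_self j)) (B k).2
  · intro u hu
    have huK : WithLp.toLp 2 u ∈ K := by
      rw [hK, Submodule.mem_orthogonal]
      intro v hv
      induction hv using Submodule.span_induction with
      | mem x hx =>
        obtain ⟨j, rfl⟩ := hx
        rw [← hu j]
        simp [hY, PiLp.inner_apply, dotProduct, mul_comm]
      | zero => simp
      | add x z _ _ hx hz => rw [inner_add_left, hx, hz, add_zero]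
      | smul c x _ hx => rw [inner_smul_left, hx, mul_zero]
    have hrepr := congrArg (Subtype.val : K → _) (B.sum_repr' ⟨WithLp.toLp 2 u, huK⟩)
    ext a
    have ha := congrArg (fun v : EuclideanSpace ℂ d => v a) hrepr
    simp only [Submodule.coe_sum, Submodule.coe_smul, Submodule.coe_inner] at ha
    refine Eq.trans ?_ ha
    simp [Matrix.mulVec, dotProduct, V, PiLp.inner_apply, mul_comm]

lemma linearIndependent_col_of_isUnit_gram [DecidableEq b] {X : Matrix d b ℂ}
    (hX : IsUnit (Xᴴ * X).det) : LinearIndependent ℂ X.col := by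
  rw [← Matrix.mulVec_injective_iff]
  intro v w hvw
  have h : (Xᴴ * X) *ᵥ v = (Xᴴ * X) *ᵥ w := by
    simp only [← Matrix.mulVec_mulVec]
    exact congrArg _ hvw
  exact Matrix.mulVec_injective_of_isUnit ((Matrix.isUnit_iff_isUnit_det _).2 hX) h

lemma isUnit_gram_iff_mulVec_injective [DecidableEq b] {X : Matrix d b ℂ} :
    IsUnit (Xᴴ * X) ↔ Function.Injective X.mulVec := by
  open scoped ComplexOrder in
  rw [← Matrix.mulVec_injective_iff_isUnit, ← Matrix.coe_mulVecLin, ← Matrix.coe_mulVecLin,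
    ← LinearMap.ker_eq_bot, ← LinearMap.ker_eq_bot, Matrix.ker_mulVecLin_conjTranspose_mul_self]

/-- By cyclicity of the trace `W` cancels, leaving only diagonal entries; off-diagonal entries of
the inverse Gram matrix never matter. -/
lemma trace_inv_gram_mul_diagonal_mul_unitary {n : Type*} [Fintype n] [DecidableEq b]
    (B : Matrix n b ℂ) {δ : b → ℝ} (hδ : ∀ i, 0 < δ i) {W : Matrix b b ℂ} (hW : Wᴴ * W = 1) :
    (((B * (Matrix.diagonal (fun i => (δ i : ℂ)) * Wᴴ))ᴴ *
      (B * (Matrix.diagonal (fun i => (δ i : ℂ)) * Wᴴ)))⁻¹).trace =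
      ∑ i, (((δ i ^ 2)⁻¹ : ℝ) : ℂ) * (Bᴴ * B)⁻¹ i i := by
  set D : Matrix b b ℂ := Matrix.diagonal (fun i => (δ i : ℂ)) with hD
  have hDD : Dᴴ = D := by
    rw [hD, Matrix.diagonal_conjTranspose]
    congr 1
    ext i
    simp
  have hW' : W * Wᴴ = 1 := mul_eq_one_comm.1 hW
  have hDinv : D⁻¹ = Matrix.diagonal (fun i => ((δ i : ℂ))⁻¹) := by
    refine Matrix.inv_eq_left_inv ?_
    rw [hD, Matrix.diagonal_mul_diagonal, ← Matrix.diagonal_one]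
    congr 1
    ext i
    exact inv_mul_cancel₀ (by exact_mod_cast (hδ i).ne')
  have hgram : (B * (D * Wᴴ))ᴴ * (B * (D * Wᴴ)) = W * (D * (Bᴴ * B) * D) * Wᴴ := by
    simp only [Matrix.conjTranspose_mul, Matrix.conjTranspose_conjTranspose, hDD, Matrix.mul_assoc]
  rw [hgram, Matrix.mul_inv_rev, Matrix.mul_inv_rev, Matrix.inv_eq_left_inv hW,
    Matrix.inv_eq_left_inv hW', Matrix.trace_mul_comm, Matrix.mul_assoc, hW, Matrix.mul_one,
    Matrix.mul_inv_rev, Matrix.mul_inv_rev, Matrix.trace_mul_comm, hDinv, Matrix.mul_assoc,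
    Matrix.diagonal_mul_diagonal, Matrix.trace]
  refine Finset.sum_congr rfl fun i _ => ?_
  rw [Matrix.diag_apply, Matrix.mul_diagonal, Complex.ofReal_inv, Complex.ofReal_pow]
  ring

open scoped ComplexOrder in
/-- Singular value decomposition of a matrix with independent columns. -/
lemma exists_eq_mul_diagonal_mul_unitary [DecidableEq b] {A : Matrix r b ℂ}
    (hA : IsUnit (Aᴴ * A)) :
    ∃ (U : Matrix r b ℂ) (δ : b → ℝ) (W : Matrix b b ℂ), (∀ i, 0 < δ i) ∧ Uᴴ * U = 1 ∧
      Wᴴ * W = 1 ∧ A = U * (Matrix.diagonal (fun i => (δ i : ℂ)) * Wᴴ) := by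
  have hpos : (Aᴴ * A).PosDef :=
    Matrix.PosDef.conjTranspose_mul_self A (isUnit_gram_iff_mulVec_injective.1 hA)
  set W : Matrix b b ℂ := hpos.1.eigenvectorUnitary.1 with hWdef
  have hW : Wᴴ * W = 1 := Unitary.coe_star_mul_self hpos.1.eigenvectorUnitary
  have hW' : W * Wᴴ = 1 := mul_eq_one_comm.1 hW
  set lam : b → ℝ := hpos.1.eigenvalues with hlam
  have hspec : Aᴴ * A = W * Matrix.diagonal (fun i => (lam i : ℂ)) * Wᴴ := by
    conv_lhs => rw [hpos.1.spectral_theorem, Unitary.conjStarAlgAut_apply]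
    rfl
  have hlam0 : ∀ i, 0 < √(lam i) := fun i => Real.sqrt_pos.2 (hpos.eigenvalues_pos i)
  set E : Matrix b b ℂ := Matrix.diagonal (fun i => ((√(lam i) : ℝ) : ℂ)⁻¹) with hE
  have hEE : Eᴴ = E := by
    rw [hE, Matrix.diagonal_conjTranspose]
    congr 1
    ext i
    simp
  -- With `W` diagonalizing `Aᴴ * A`, the columns of `A * W` are orthogonal of norm `√(lam i)`, and
  -- `E` normalizes them.
  refine ⟨A * (W * E), fun i => √(lam i), W, hlam0, ?_, hW, ?_⟩
  · calc (A * (W * E))ᴴ * (A * (W * E)) = E * (Wᴴ * (Aᴴ * A) * W) * E := by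
          simp only [Matrix.conjTranspose_mul, hEE, Matrix.mul_assoc]
      _ = E * ((Wᴴ * W) * Matrix.diagonal (fun i => (lam i : ℂ)) * (Wᴴ * W)) * E := by
          rw [hspec]
          simp only [Matrix.mul_assoc]
      _ = 1 := by
          rw [hW, Matrix.one_mul, Matrix.mul_one, hE, Matrix.diagonal_mul_diagonal,
            Matrix.diagonal_mul_diagonal, ← Matrix.diagonal_one]
          congr 1
          ext i
          have h0 : ((√(lam i) : ℝ) : ℂ) ≠ 0 := by exact_mod_cast (hlam0 i).ne'
          have h1 : (lam i : ℂ) = ((√(lam i) : ℝ) : ℂ) * ((√(lam i) : ℝ) : ℂ) := by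
            rw [← Complex.ofReal_mul, Real.mul_self_sqrt (hpos.eigenvalues_pos i).le]
          rw [h1]
          field_simp
  · have hED : E * Matrix.diagonal (fun i => ((√(lam i) : ℝ) : ℂ)) = 1 := by
      rw [hE, Matrix.diagonal_mul_diagonal, ← Matrix.diagonal_one]
      congr 1
      ext i
      exact inv_mul_cancel₀ (by exact_mod_cast (hlam0 i).ne')
    calc A = A * (W * Wᴴ) := by rw [hW', Matrix.mul_one]
      _ = A * (W * (E * Matrix.diagonal (fun i => ((√(lam i) : ℝ) : ℂ))) * Wᴴ) := by
          rw [hED, Matrix.mul_one]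
      _ = _ := by simp only [Matrix.mul_assoc]

end LinearAlgebra

/-! ### Measurability of matrix operations -/

section Measurability

variable {α m n p : Type*} [MeasurableSpace α]

lemma measurable_matrix_iff {M : α → Matrix m n ℂ} :
    Measurable M ↔ ∀ i j, Measurable fun x => M x i j :=
  ⟨fun h i j => (measurable_pi_apply j).comp ((measurable_pi_apply i).comp h),
    fun h => measurable_pi_lambda _ fun i => measurable_pi_lambda _ fun j => h i j⟩

lemma measurable_matrix_mul [Fintype n] {M : α → Matrix m n ℂ} {N : α → Matrix n p ℂ}
    (hM : Measurable M) (hN : Measurable N) : Measurable fun x => M x * N x := by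
  rw [measurable_matrix_iff] at *
  intro i j
  simp only [Matrix.mul_apply]
  exact Finset.measurable_sum _ fun k _ => (hM i k).mul (hN k j)

lemma measurable_matrix_conjTranspose {M : α → Matrix m n ℂ} (hM : Measurable M) :
    Measurable fun x => (M x)ᴴ := by
  rw [measurable_matrix_iff] at *
  intro i j
  exact Complex.continuous_conj.measurable.comp (hM j i)

lemma measurable_matrix_det [Fintype n] [DecidableEq n] {M : α → Matrix n n ℂ}
    (hM : Measurable M) : Measurable fun x => (M x).det := by
  rw [measurable_matrix_iff] at hM
  simp only [Matrix.det_apply]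
  exact Finset.measurable_sum _ fun σ _ =>
    (Finset.measurable_prod _ fun i _ => hM (σ i) i).const_smul _

/-- The formula `det⁻¹ • adjugate` also covers singular matrices, where the convention `0⁻¹ = 0`
gives zero. -/
lemma measurable_matrix_inv [Fintype n] [DecidableEq n] {M : α → Matrix n n ℂ}
    (hM : Measurable M) : Measurable fun x => (M x)⁻¹ := by
  rw [measurable_matrix_iff]
  intro i j
  simp only [Matrix.inv_def, Ring.inverse_eq_inv', Matrix.smul_apply, smul_eq_mul,
    Matrix.adjugate_apply]
  refine (measurable_matrix_det hM).inv.mul (measurable_matrix_det ?_)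
  rw [measurable_matrix_iff] at *
  intro k l
  by_cases hk : k = j
  · subst hk
    simp
  · simpa [Matrix.updateRow_ne hk] using hM k l

lemma measurable_matrix_trace [Fintype n] {M : α → Matrix n n ℂ}
    (hM : Measurable M) : Measurable fun x => (M x).trace := by
  rw [measurable_matrix_iff] at hM
  simp only [Matrix.trace]
  exact Finset.measurable_sum _ fun i _ => hM i i

lemma measurable_matrix_gram [Fintype m] {M : α → Matrix m n ℂ}
    (hM : Measurable M) : Measurable fun x => (M x)ᴴ * M x :=
  measurable_matrix_mul (measurable_matrix_conjTranspose hM) hM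

end Measurability

/-! ### Inverse complex Wishart matrices -/

section GaussianMatrix

variable {d r b : Type*} [Fintype d] [Fintype r] [Fintype b]

/-- The matrix with the given family of entries. -/
def matrixOfEntries {m n : Type*} (x : m × n → ℂ) : Matrix m n ℂ :=
  Matrix.of fun i j => x (i, j)

lemma measurable_matrixOfEntries {m n : Type*} :
    Measurable (matrixOfEntries : (m × n → ℂ) → Matrix m n ℂ) :=
  measurable_matrix_iff.2 fun i j => measurable_pi_apply (i, j)

/-- Right multiplication by a matrix with orthonormal columns maps a standard complex Gaussian
matrix to a standard complex Gaussian matrix. -/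
lemma exists_measurePreserving_matrixOfEntries_mul [DecidableEq d] [DecidableEq b]
    {U : Matrix r b ℂ} (hU : Uᴴ * U = 1) :
    ∃ T : (d × r → ℂ) → (d × b → ℂ), MeasurePreserving T (cscgPi (d × r)) (cscgPi (d × b)) ∧
      ∀ x, matrixOfEntries (T x) = matrixOfEntries x * U := by
  -- On the vector of entries, `X ↦ X U` acts as `1 ⊗ Uᵀ`, whose rows are orthonormal.
  have hT : (Matrix.kroneckerMap (· * ·) (1 : Matrix d d ℂ) Uᵀ) *
      (Matrix.kroneckerMap (· * ·) (1 : Matrix d d ℂ) Uᵀ)ᴴ = 1 := by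
    rw [Matrix.conjTranspose_kronecker, ← Matrix.mul_kronecker_mul, Matrix.conjTranspose_one,
      Matrix.one_mul]
    have : Uᵀ * Uᵀᴴ = 1 := by
      rw [← Matrix.transpose_one, ← hU, Matrix.transpose_mul]
      rfl
    rw [this]
    exact Matrix.one_kronecker_one
  refine ⟨_, measurePreserving_mulVec_cscgPi hT, fun x => ?_⟩
  ext i j
  simp [matrixOfEntries, Matrix.mulVec, dotProduct, Matrix.mul_apply, Fintype.sum_prod_type,
    Matrix.one_apply, mul_comm]

/-- The mean of a diagonal entry of an inverse complex Wishart matrix. -/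
lemma lintegral_inv_wishart_diag [DecidableEq d] [DecidableEq b]
    (hcard : Fintype.card b < Fintype.card d)
    (hne : ∀ᵐ x ∂(cscgPi (d × b)),
      IsUnit ((matrixOfEntries x)ᴴ * matrixOfEntries x).det) (i : b) :
    ∫⁻ x, ENNReal.ofReal (((matrixOfEntries x)ᴴ * matrixOfEntries x)⁻¹ i i).re
        ∂(cscgPi (d × b)) =
      ENNReal.ofReal (((Fintype.card d : ℝ) - Fintype.card b)⁻¹) := by
  obtain ⟨n, hn⟩ := Nat.exists_eq_add_of_lt hcard
  have hcardτ : Fintype.card {j : b // j ≠ i} + 1 = Fintype.card b := by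
    rw [Fintype.card_subtype_compl, Fintype.card_subtype_eq]
    have : 0 < Fintype.card b := Fintype.card_pos_iff.2 ⟨i⟩
    omega
  -- Separates column `i` (the variable `z`) from the other columns (`y`), so that `y` can be
  -- frozen.
  let e := MeasurableEquiv.piEquivPiSubtypeProd (fun _ : d × b => ℂ) (fun q => q.2 ≠ i)
  have he : MeasurePreserving e.symm ((cscgPi {q : d × b // q.2 ≠ i}).prod
      (cscgPi {q : d × b // ¬ q.2 ≠ i})) (cscgPi (d × b)) :=
    (measurePreserving_piEquivPiSubtypeProd (fun _ : d × b => cscg) (fun q => q.2 ≠ i)).symm _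
  have hmeas : Measurable fun x : d × b → ℂ =>
      ENNReal.ofReal (((matrixOfEntries x)ᴴ * matrixOfEntries x)⁻¹ i i).re :=
    (Complex.measurable_re.comp (measurable_matrix_iff.1 (measurable_matrix_inv
      (measurable_matrix_gram measurable_matrixOfEntries)) i i)).ennreal_ofReal
  have hne' := Measure.ae_ae_of_ae_prod (he.quasiMeasurePreserving.ae hne)
  rw [← he.lintegral_comp hmeas]
  refine (lintegral_prod _ (hmeas.comp e.symm.measurable).aemeasurable).trans ?_
  simp only [Function.comp_apply]
  have hfst : ∀ (y : {q : d × b // q.2 ≠ i} → ℂ) (z : {q : d × b // ¬ q.2 ≠ i} → ℂ) j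
      (hj : j ≠ i), (matrixOfEntries (e.symm (y, z))).col j = fun a => y ⟨(a, j), hj⟩ := by
    intro y z j hj
    ext a
    exact dif_pos hj
  have hsnd : ∀ (y : {q : d × b // q.2 ≠ i} → ℂ) (z : {q : d × b // ¬ q.2 ≠ i} → ℂ),
      (matrixOfEntries (e.symm (y, z))).col i = fun a => z ⟨(a, i), by simp⟩ := by
    intro y z
    ext a
    exact dif_neg (by simp)
  have hinner : ∀ᵐ y ∂(cscgPi {q : d × b // q.2 ≠ i}),
      ∫⁻ z, ENNReal.ofReal (((matrixOfEntries (e.symm (y, z)))ᴴ *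
        matrixOfEntries (e.symm (y, z)))⁻¹ i i).re ∂(cscgPi {q : d × b // ¬ q.2 ≠ i}) =
      ENNReal.ofReal (((Fintype.card d : ℝ) - Fintype.card b)⁻¹) := by
    filter_upwards [hne'] with y hy
    -- A single good value of column `i` already forces the other columns to be independent.
    obtain ⟨z₀, hz₀⟩ := hy.exists
    have hli : LinearIndependent ℂ fun (j : {j : b // j ≠ i}) (a : d) => y ⟨(a, j.1), j.2⟩ := by
      have h := (linearIndependent_col_of_isUnit_gram hz₀).comp (Subtype.val : {j // j ≠ i} → b)
        Subtype.val_injective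
      convert h using 1
      ext j a
      exact (congrFun (hfst y z₀ j.1 j.2) a).symm
    -- Here `card d = card b + n + 1` and `card b - 1` columns are removed, leaving dimension `n +
    -- 2`; the inverse moment is then `1 / (n + 1) = 1 / (card d - card b)`.
    obtain ⟨V, hVV, hVy, hV⟩ := exists_orthonormal_rows_compl hli (m := n + 1 + 1) (by omega)
    let f : d ≃ {q : d × b // ¬ q.2 ≠ i} :=
      { toFun := fun a => ⟨(a, i), by simp⟩
        invFun := fun q => q.1.1
        left_inv := fun a => rfl
        right_inv := by
          rintro ⟨⟨a, j⟩, hj⟩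
          simp only [ne_eq, not_not] at hj
          subst hj
          rfl }
    have hT : (V.submatrix id f.symm) * (V.submatrix id f.symm)ᴴ = 1 := by
      rw [Matrix.conjTranspose_submatrix, Matrix.submatrix_mul_equiv, hVV, Matrix.submatrix_id_id]
    have hTz : ∀ z : {q : d × b // ¬ q.2 ≠ i} → ℂ,
        (V.submatrix id f.symm) *ᵥ z = V *ᵥ fun a => z (f a) := by
      intro z
      ext k
      exact Fintype.sum_equiv f.symm _ _ fun q => by simp
    have hmp := measurePreserving_mulVec_cscgPi hT
    have hval : ∀ᵐ z ∂(cscgPi {q : d × b // ¬ q.2 ≠ i}),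
        ENNReal.ofReal (((matrixOfEntries (e.symm (y, z)))ᴴ *
          matrixOfEntries (e.symm (y, z)))⁻¹ i i).re =
        (ENNReal.ofReal (∑ k, ‖((V.submatrix id f.symm) *ᵥ z) k‖ ^ 2))⁻¹ := by
      filter_upwards [hy] with z hz
      have hkey := inv_gram_diag_mul_sum_norm_sq hz i (V := V)
        (fun j hj => by rw [hfst y z j hj]; exact hVy ⟨j, hj⟩)
        (fun u hu => hV u fun j => by rw [← hu j.1 j.2, hfst y z j.1 j.2])
      rw [hsnd y z] at hkey
      rw [hTz]
      have hre := congrArg Complex.re hkey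
      rw [Complex.re_mul_ofReal, Complex.one_re] at hre
      have hs : 0 ≤ ∑ k, ‖(V *ᵥ fun a => z (f a)) k‖ ^ 2 :=
        Finset.sum_nonneg fun k _ => by positivity
      have hs0 : 0 < ∑ k, ‖(V *ᵥ fun a => z (f a)) k‖ ^ 2 := by
        refine hs.lt_of_ne fun h0 => ?_
        have h1 := hre
        change _ * (∑ k, ‖(V *ᵥ fun a => z (f a)) k‖ ^ 2) = 1 at h1
        rw [← h0, mul_zero] at h1
        exact zero_ne_one h1
      rw [← ENNReal.ofReal_inv_of_pos hs0]
      congr 1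
      exact eq_inv_of_mul_eq_one_left hre
    rw [lintegral_congr_ae hval, hmp.lintegral_comp (f := fun x =>
      (ENNReal.ofReal (∑ k, ‖x k‖ ^ 2))⁻¹) (by fun_prop),
      lintegral_inv_sum_norm_sq_cscgPi (Nat.succ_pos n) (by simp)]
    congr 2
    rw [hn]
    push_cast
    ring
  rw [lintegral_congr_ae hinner]
  simp

open scoped ComplexOrder in
-- The inverse of a positive semidefinite matrix has nonnegative diagonal, even in the singular
-- case, so the finite `lintegral` gives both integrability and the value.
lemma integrable_inv_wishart_diag [DecidableEq d] [DecidableEq b]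
    (hcard : Fintype.card b < Fintype.card d)
    (hne : ∀ᵐ x ∂(cscgPi (d × b)),
      IsUnit ((matrixOfEntries x)ᴴ * matrixOfEntries x).det) (i : b) :
    Integrable (fun x => ((matrixOfEntries x)ᴴ * matrixOfEntries x)⁻¹ i i) (cscgPi (d × b)) ∧
    ∫ x, ((matrixOfEntries x)ᴴ * matrixOfEntries x)⁻¹ i i ∂(cscgPi (d × b)) =
      ((Fintype.card d : ℂ) - Fintype.card b)⁻¹ := by
  have hlint := lintegral_inv_wishart_diag hcard hne i
  have hmeas : Measurable fun x : d × b → ℂ =>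
      (((matrixOfEntries x)ᴴ * matrixOfEntries x)⁻¹ i i).re :=
    Complex.measurable_re.comp (measurable_matrix_iff.1 (measurable_matrix_inv
      (measurable_matrix_gram measurable_matrixOfEntries)) i i)
  have hnonneg : ∀ x : d × b → ℂ, 0 ≤ ((matrixOfEntries x)ᴴ * matrixOfEntries x)⁻¹ i i :=
    fun x => (Matrix.posSemidef_conjTranspose_mul_self (matrixOfEntries x)).inv.diag_nonneg
  have hcoe : (fun x : d × b → ℂ => ((matrixOfEntries x)ᴴ * matrixOfEntries x)⁻¹ i i) =
      fun x => (((((matrixOfEntries x)ᴴ * matrixOfEntries x)⁻¹ i i).re : ℝ) : ℂ) :=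
    funext fun x => Complex.eq_re_of_ofReal_le (hnonneg x)
  have hre : ∀ x : d × b → ℂ, 0 ≤ (((matrixOfEntries x)ᴴ * matrixOfEntries x)⁻¹ i i).re :=
    fun x => (Complex.le_def.1 (hnonneg x)).1
  have hint : Integrable (fun x : d × b → ℂ =>
      (((matrixOfEntries x)ᴴ * matrixOfEntries x)⁻¹ i i).re) (cscgPi (d × b)) := by
    refine ⟨hmeas.aestronglyMeasurable, ?_⟩
    rw [hasFiniteIntegral_iff_ofReal (ae_of_all _ hre), hlint]
    exact ENNReal.ofReal_lt_top
  rw [hcoe]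
  constructor
  · exact hint.ofReal
  · rw [integral_complex_ofReal, integral_eq_lintegral_of_nonneg_ae (ae_of_all _ hre)
      hmeas.aestronglyMeasurable, hlint, ENNReal.toReal_ofReal]
    · push_cast
      rfl
    · rw [inv_nonneg, sub_nonneg]
      exact_mod_cast hcard.le

/-- If `X` is a standard complex Gaussian `d × r` matrix and `A` is an `r × b` matrix such that
`X A` almost surely has independent columns, then the mean of `tr (((X A)ᴴ (X A))⁻¹)` is
`tr ((Aᴴ A)⁻¹) / (d - b)`. -/
lemma integrable_trace_inv_gram_mul [DecidableEq d] [DecidableEq b]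
    (hcard : Fintype.card b < Fintype.card d) {A : Matrix r b ℂ}
    (hne : ∀ᵐ x ∂(cscgPi (d × r)),
      IsUnit ((matrixOfEntries x * A)ᴴ * (matrixOfEntries x * A))) :
    IsUnit (Aᴴ * A) ∧
    Integrable (fun x => (((matrixOfEntries x * A)ᴴ * (matrixOfEntries x * A))⁻¹).trace)
      (cscgPi (d × r)) ∧
    ∫ x, (((matrixOfEntries x * A)ᴴ * (matrixOfEntries x * A))⁻¹).trace ∂(cscgPi (d × r)) =
      ((Aᴴ * A)⁻¹).trace / ((Fintype.card d : ℂ) - Fintype.card b) := by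
  have hA : IsUnit (Aᴴ * A) := by
    obtain ⟨x, hx⟩ := hne.exists
    rw [isUnit_gram_iff_mulVec_injective] at hx ⊢
    intro v w hvw
    apply hx
    simp only [← Matrix.mulVec_mulVec]
    exact congrArg _ hvw
  obtain ⟨U, δ, W, hδ, hU, hW, hAU⟩ := exists_eq_mul_diagonal_mul_unitary hA
  obtain ⟨T, hT, hTU⟩ := exists_measurePreserving_matrixOfEntries_mul (d := d) hU
  have hdet : Measurable fun x : d × b → ℂ =>
      ((matrixOfEntries x)ᴴ * matrixOfEntries x).det :=
    measurable_matrix_det (measurable_matrix_gram measurable_matrixOfEntries)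
  -- Almost sure invertibility is inherited from `hne`: the Gram matrix of `X A` contains that of `X
  -- U` as a factor.
  have hwishart : ∀ᵐ x ∂(cscgPi (d × b)),
      IsUnit ((matrixOfEntries x)ᴴ * matrixOfEntries x).det := by
    simp only [isUnit_iff_ne_zero]
    rw [← hT.map_eq]
    refine (ae_map_iff hT.aemeasurable (hdet (measurableSet_singleton 0).compl)).2 ?_
    filter_upwards [hne] with x hx
    change ((matrixOfEntries (T x))ᴴ * matrixOfEntries (T x)).det ≠ 0
    rw [← isUnit_iff_ne_zero, ← Matrix.isUnit_iff_isUnit_det, hTU]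
    have hfac : (matrixOfEntries x * A)ᴴ * (matrixOfEntries x * A) =
        (Matrix.diagonal (fun i => (δ i : ℂ)) * Wᴴ)ᴴ *
          ((matrixOfEntries x * U)ᴴ * (matrixOfEntries x * U)) *
          (Matrix.diagonal (fun i => (δ i : ℂ)) * Wᴴ) := by
      rw [hAU]
      simp only [Matrix.conjTranspose_mul, Matrix.mul_assoc]
    rw [hfac, Matrix.isUnit_iff_isUnit_det, Matrix.det_mul, Matrix.det_mul] at hx
    rw [Matrix.isUnit_iff_isUnit_det]
    exact isUnit_of_mul_isUnit_right (isUnit_of_mul_isUnit_left hx)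
  have htrace : ∀ x : d × r → ℂ,
      (((matrixOfEntries x * A)ᴴ * (matrixOfEntries x * A))⁻¹).trace =
      ∑ i, (((δ i ^ 2)⁻¹ : ℝ) : ℂ) *
        ((matrixOfEntries (T x))ᴴ * matrixOfEntries (T x))⁻¹ i i := by
    intro x
    rw [hTU, ← trace_inv_gram_mul_diagonal_mul_unitary _ hδ hW, Matrix.mul_assoc _ U, ← hAU]
  have htraceR : ((Aᴴ * A)⁻¹).trace = ∑ i, (((δ i ^ 2)⁻¹ : ℝ) : ℂ) := by
    conv_lhs => rw [hAU]
    rw [trace_inv_gram_mul_diagonal_mul_unitary _ hδ hW, hU]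
    simp
  have hdiag := integrable_inv_wishart_diag hcard hwishart
  have hint : ∀ i, Integrable (fun x : d × r → ℂ =>
      ((matrixOfEntries (T x))ᴴ * matrixOfEntries (T x))⁻¹ i i) (cscgPi (d × r)) :=
    fun i => hT.integrable_comp_of_integrable (hdiag i).1
  refine ⟨hA, ?_, ?_⟩
  · simp_rw [htrace]
    exact integrable_finsetSum _ fun i _ => (hint i).const_mul _
  · simp_rw [htrace]
    rw [integral_finsetSum _ fun i _ => (hint i).const_mul _, htraceR, div_eq_mul_inv,
      Finset.sum_mul]
    refine Finset.sum_congr rfl fun i _ => ?_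
    rw [integral_const_mul, ← (hdiag i).2]
    congr 1
    rw [← hT.map_eq, integral_map hT.aemeasurable]
    rw [hT.map_eq]
    exact (hdiag i).1.aestronglyMeasurable

end GaussianMatrix

/-! ### Rank conditions on the dual-hop channel -/

lemma mulVec_injective_of_rank_eq_card {m n : Type*} [Fintype n] {A : Matrix m n ℂ}
    (hA : A.rank = Fintype.card n) : Function.Injective A.mulVec := by
  rw [Matrix.mulVec_injective_iff, linearIndependent_iff_card_eq_finrank_span, ← hA,
    Matrix.rank_eq_finrank_span_cols]
  rfl

section DualHop

variable {d r s b : Type*} [Fintype d] [Fintype r] [Fintype s]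

lemma gramC_eq (G : Matrix d r ℂ) (F : Matrix r r ℂ) (H : Matrix r s ℂ) (F₀ : Matrix s b ℂ) :
    gramC G F H F₀ = (G * (F * H * F₀))ᴴ * (G * (F * H * F₀)) := by
  simp only [gramC, dualHop, Matrix.mul_assoc]

lemma gramR_eq (F : Matrix r r ℂ) (H : Matrix r s ℂ) (F₀ : Matrix s b ℂ) :
    gramR F H F₀ = (F * H * F₀)ᴴ * (F * H * F₀) := by
  simp only [gramR, Matrix.conjTranspose_mul, Matrix.mul_assoc]

lemma isUnit_gramC_of_rank [Fintype b] [DecidableEq b] {G : Matrix d r ℂ} {F : Matrix r r ℂ}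
    {H : Matrix r s ℂ} {F₀ : Matrix s b ℂ} (h₀ : F₀.rank = Fintype.card b)
    (h : (G * F * H).rank = Fintype.card s) : IsUnit (gramC G F H F₀) := by
  rw [gramC, isUnit_gram_iff_mulVec_injective, dualHop]
  intro v w hvw
  apply mulVec_injective_of_rank_eq_card h₀
  apply mulVec_injective_of_rank_eq_card h
  simpa only [Matrix.mulVec_mulVec] using hvw

end DualHop

/-! ### Law of the second hop and conditioning on the first -/

section Probability

variable {Ω : Type*} [MeasurableSpace Ω] {P : Measure Ω}

lemma HasIIDCSCGEntries.map_eq [IsProbabilityMeasure P] {m n : Type*} [Fintype m] [Fintype n]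
    {G : Ω → Matrix m n ℂ} (hG : Measurable G) (h : HasIIDCSCGEntries G P) :
    P.map G = (cscgPi (m × n)).map matrixOfEntries := by
  have hentry : ∀ p : m × n, Measurable fun ω => G ω p.1 p.2 :=
    fun p => measurable_matrix_iff.1 hG p.1 p.2
  have hpi := (iIndepFun_iff_map_fun_eq_pi_map fun p => (hentry p).aemeasurable).1 h.indep
  simp_rw [fun p : m × n => (h.hasLaw p.1 p.2).map_eq] at hpi
  rw [cscgPi, ← hpi, Measure.map_map measurable_matrixOfEntries (measurable_pi_lambda _ hentry)]
  rfl

/-- Under independence the joint law is a product, which is the composition of the law of `X` with a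
constant kernel; disintegration is unique. -/
lemma condDistrib_ae_eq_map_of_indepFun [IsFiniteMeasure P] {α β : Type*} [MeasurableSpace α]
    [StandardBorelSpace α] [Nonempty α] [MeasurableSpace β] {Y : Ω → α} {X : Ω → β}
    (hY : Measurable Y) (hX : Measurable X) (h : IndepFun Y X P) :
    ∀ᵐ x ∂(P.map X), condDistrib Y X P x = P.map Y := by
  have : condDistrib Y X P =ᵐ[P.map X] Kernel.const β (P.map Y) := by
    rw [condDistrib_ae_eq_iff_measure_eq_compProd X hY.aemeasurable, Measure.compProd_const]
    exact (indepFun_iff_map_prod_eq_prod_map_map hX.aemeasurable hY.aemeasurable).1 h.symm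
  filter_upwards [this] with x hx
  rw [hx, Kernel.const_apply]

end Probability

theorem lemma1
    -- numbers of relays, relay antennas, source antennas, symbols and destination antennas
    (NC NR NS NB ND : ℕ)
    {Ω : Type*} [MeasurableSpace Ω] (P : Measure Ω) [IsProbabilityMeasure P]
    -- first-hop channel (of arbitrary law) and second-hop channel
    (H : Ω → Matrix (Fin NC × Fin NR) (Fin NS) ℂ) (hH : Measurable H)
    (G : Ω → Matrix (Fin ND) (Fin NC × Fin NR) ℂ) (hG : Measurable G)
    (hGlaw : HasIIDCSCGEntries G P) (hGH : IndepFun G H P)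
    -- precoder and relaying matrix; both may be chosen from the knowledge of the first hop
    (F₀ : Matrix (Fin NC × Fin NR) (Fin NS) ℂ → Matrix (Fin NS) (Fin NB) ℂ)
    (hF₀ : Measurable F₀)
    (F : Matrix (Fin NC × Fin NR) (Fin NS) ℂ →
      Matrix (Fin NC × Fin NR) (Fin NC × Fin NR) ℂ)
    (hF : Measurable F)
    (a1 : ∀ᵐ ω ∂P, (F₀ (H ω)).rank = NB)
    (a2 : ∀ᵐ ω ∂P, (G ω * F (H ω) * H ω).rank = NS)
    (a3 : NB < ND) :
    -- averages over the conditional law of `G` given `H = h`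
    (∀ᵐ h ∂(P.map H),
      IsUnit (gramR (F h) h (F₀ h)) ∧
      (∀ᵐ g ∂(condDistrib G H P h), IsUnit (gramC g (F h) h (F₀ h))) ∧
      Integrable (fun g => ((gramC g (F h) h (F₀ h))⁻¹).trace) (condDistrib G H P h) ∧
      ∫ g, ((gramC g (F h) h (F₀ h))⁻¹).trace ∂(condDistrib G H P h)
        = ((gramR (F h) h (F₀ h))⁻¹).trace / ((ND : ℂ) - (NB : ℂ))) ∧
    -- conditional expectation given the sigma-algebra of `H`, when it is defined
    (Integrable (fun ω => ((gramC (G ω) (F (H ω)) (H ω) (F₀ (H ω)))⁻¹).trace) P →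
      P[fun ω => ((gramC (G ω) (F (H ω)) (H ω) (F₀ (H ω)))⁻¹).trace |
          MeasurableSpace.comap H inferInstance]
        =ᵐ[P] fun ω =>
          ((gramR (F (H ω)) (H ω) (F₀ (H ω)))⁻¹).trace / ((ND : ℂ) - (NB : ℂ))) := by
  have hgram : Measurable fun q : Matrix (Fin NC × Fin NR) (Fin NS) ℂ ×
      Matrix (Fin ND) (Fin NC × Fin NR) ℂ => gramC q.2 (F q.1) q.1 (F₀ q.1) :=
    measurable_matrix_gram (measurable_matrix_mul (measurable_matrix_mul (measurable_matrix_mul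
      measurable_snd (hF.comp measurable_fst)) measurable_fst) (hF₀.comp measurable_fst))
  have htrace : Measurable fun q : Matrix (Fin NC × Fin NR) (Fin NS) ℂ ×
      Matrix (Fin ND) (Fin NC × Fin NR) ℂ => ((gramC q.2 (F q.1) q.1 (F₀ q.1))⁻¹).trace :=
    measurable_matrix_trace (measurable_matrix_inv hgram)
  have hunit : ∀ᵐ ω ∂P, (gramC (G ω) (F (H ω)) (H ω) (F₀ (H ω))).det ≠ 0 := by
    filter_upwards [a1, a2] with ω h₀ h
    rw [← isUnit_iff_ne_zero, ← Matrix.isUnit_iff_isUnit_det]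
    exact isUnit_gramC_of_rank (by simpa using h₀) (by simpa using h)
  -- The joint law being a product, the almost sure rank conditions pass to almost every fixed `h`,
  -- with `g` still random.
  have hprod : ∀ᵐ h ∂(P.map H), ∀ᵐ g ∂(P.map G), (gramC g (F h) h (F₀ h)).det ≠ 0 := by
    have hae : ∀ᵐ q ∂(P.map fun ω => (H ω, G ω)), (gramC q.2 (F q.1) q.1 (F₀ q.1)).det ≠ 0 :=
      (ae_map_iff (hH.prodMk hG).aemeasurable
        (measurable_matrix_det hgram (measurableSet_singleton 0).compl)).2 hunit
    rw [(indepFun_iff_map_prod_eq_prod_map_map hH.aemeasurable hG.aemeasurable).1 hGH.symm] at hae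
    exact Measure.ae_ae_of_ae_prod hae
  have hmain : ∀ᵐ h ∂(P.map H),
      IsUnit (gramR (F h) h (F₀ h)) ∧
      (∀ᵐ g ∂(condDistrib G H P h), IsUnit (gramC g (F h) h (F₀ h))) ∧
      Integrable (fun g => ((gramC g (F h) h (F₀ h))⁻¹).trace) (condDistrib G H P h) ∧
      ∫ g, ((gramC g (F h) h (F₀ h))⁻¹).trace ∂(condDistrib G H P h)
        = ((gramR (F h) h (F₀ h))⁻¹).trace / ((ND : ℂ) - (NB : ℂ)) := by
    filter_upwards [hprod, condDistrib_ae_eq_map_of_indepFun hG hH hGH] with h hh hcond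
    have hh' : ∀ᵐ g ∂(P.map G), IsUnit (gramC g (F h) h (F₀ h)) := by
      filter_upwards [hh] with g hg
      rwa [Matrix.isUnit_iff_isUnit_det, isUnit_iff_ne_zero]
    have hmeas : Measurable fun g : Matrix (Fin ND) (Fin NC × Fin NR) ℂ =>
        ((gramC g (F h) h (F₀ h))⁻¹).trace :=
      measurable_matrix_trace (measurable_matrix_inv (measurable_matrix_gram
        (measurable_matrix_mul (measurable_matrix_mul (measurable_matrix_mul measurable_id
          measurable_const) measurable_const) measurable_const)))
    rw [hcond]
    rw [hGlaw.map_eq hG] at hh' ⊢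
    have hx : ∀ᵐ x ∂(cscgPi (Fin ND × Fin NC × Fin NR)),
        IsUnit ((matrixOfEntries x * (F h * h * F₀ h))ᴴ *
          (matrixOfEntries x * (F h * h * F₀ h))) := by
      filter_upwards [ae_of_ae_map measurable_matrixOfEntries.aemeasurable hh'] with x hx
      rwa [← gramC_eq]
    have hcard : Fintype.card (Fin NB) < Fintype.card (Fin ND) := by simpa using a3
    obtain ⟨hR, hint, hval⟩ := integrable_trace_inv_gram_mul hcard hx
    rw [integrable_map_measure hmeas.aestronglyMeasurable measurable_matrixOfEntries.aemeasurable,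
      integral_map measurable_matrixOfEntries.aemeasurable hmeas.aestronglyMeasurable, gramR_eq]
    refine ⟨hR, hh', ?_, ?_⟩
    · simpa only [Function.comp_def, gramC_eq] using hint
    · simpa only [gramC_eq, Fintype.card_fin] using hval
  refine ⟨hmain, fun hint => ?_⟩
  -- Joint integrability is needed only here: `hmain` integrates over `g` alone and says nothing on
  -- the integrability of `tr R⁻¹` in `h`.
  refine (condExp_prod_ae_eq_integral_condDistrib hH hG.aemeasurable htrace.stronglyMeasurable
    hint).trans ?_
  filter_upwards [ae_of_ae_map hH.aemeasurable hmain] with ω hω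
  exact hω.2.2.2
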